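/- **Theorem (extended order domain codes).** Let $\mathbb F_q\subseteq\mathbb F_{q^r}$ be finite fields, let $\prec$ be a monomial ordering on $\mathbb N^s$, and let $\Gamma\subseteq\mathbb N^s$ be a subsemigroup containing $0$. Let $(R,\rho,\Gamma)$ be an order domain over $\mathbb F_q$, that is, $R$ is a commutative $\mathbb F_q$-algebra and $\rho:R\to\Gamma\cup\{-\infty\}$ is a surjective map such that, for all $f,g,k\in R$: $\rho(f)=-\infty$ iff $f=0$; $\rho(af)=\rho(f)$ for $a\in\mathbb F_q\setminus\{0\}$; $\rho(f+g)\preceq\max\{\rho(f),\rho(g)\}$, with equality if $\rho(f)\prec\rho(g)$; if $\rho(f)\prec\rho(g)$ and $k\ne0$ then $\rho(fk)\prec\rho(gk)$; if $f,g\neq0$ and $\rho(f)=\rho(g)$ then $\rho(f-ag)\prec\rho(g)$ for some $a\in\mathbb F_q\setminus\{0\}$; and $\rho(fg)=\rho(f)+\rho(g)$ for $f,g\ne0$. Let $\{f_\lambda\mid\lambda\in\Gamma\}$ be an $\mathbb F_q$-basis of $R$ with $\rho(f_\lambda)=\lambda$, and let $R'=\mathbb F_{q^r}\otimes_{\mathbb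 F_q}R$, the $\mathbb F_{q^r}$-algebra with basis $\{f_\lambda\}$, so that $R\subseteq R'$. Let $h\ge1$ and let $\phi=(\phi_1,\dots,\phi_h):R'\to\mathbb F_{q^r}^h$ be a surjective $\mathbb F_{q^r}$-linear map that is multiplicative for the component-wise product. For $i=1,\dots,h$ put $r_i=\min\{l : \phi_i(R)\subseteq\mathbb F_{q^l}\}$, and let $\pi_i:\mathbb F_{q^{r_i}}\to C_i$ be an $\mathbb F_q$-linear isomorphism onto a linear code $C_i\subseteq\mathbb F_q^{n_i}$ with parameters $[n_i,r_i,d_i]$. Let $\alpha(1)=0$ and, for $i=2,\dots,h$, let $\alpha(i)$ be the $\prec$-smallest element $\mu\in\Gamma$ greater than $\alpha(1),\dots,\alpha(i-1)$ with $\phi(f_\mu)\notin\mathrm{Span}_{\mathbb F_{q^r}}\{\phi(f_\nu)\mid\nu\in\Gamma,\ \nu\prec\mu\}$. Let $\Delta=\{\alpha(1),\dots,\alpha(h)\}$ and $\sigma_\Delta(\eta)=|\{\mu\in\Delta\mid\mu-\eta\in\Gamma\}|$ for $\eta\in\Delta$. For $\lambda\in\Gamma$ and a non-negative integer $\delta$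 let $$E(\lambda,\mathcal R,\mathcal C)=\mathrm{Span}_{\mathbb F_q}\{(\pi_1(\phi_1(f_\eta)),\dots,\pi_h(\phi_h(f_\eta)))\mid\eta\in\Gamma,\ \eta\preceq\lambda\},$$ $$\hat E(\delta,\mathcal R,\mathcal C)=\mathrm{Span}_{\mathbb F_q}\{(\pi_1(\phi_1(f_\eta)),\dots,\pi_h(\phi_h(f_\eta)))\mid\eta\in\Delta,\ \sigma_\Delta(\eta)\ge\delta\}.$$ Then the minimum distance of $E(\lambda,\mathcal R,\mathcal C)$ is at least $\gamma\hat d$, where $\gamma=\min\{\sigma_\Delta(\eta)\mid\eta\in\Delta,\ \eta\preceq\lambda\}$ and $\hat d=\min\{d_1,\dots,d_h\}$; and the minimum distance of $\hat E(\delta,\mathcal R,\mathcal C)$ is at least $\delta\hat d$. (The zero code has minimum distance $\infty$ by convention.) -/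

import Mathlib

open scoped MonomialOrder TensorProduct

noncomputable section

namespace OrderDomain

/-! ### Weight functions and order domains -/

/-- `(R, ρ, Γ)` is an order domain over the field `F`: `Γ` is a subsemigroup (with `0`) of `ℕ^s`,
ordered by the monomial order `m` of `ℕ^s`, and `ρ : R → Γ ∪ {-∞}` is a weight function.
The values of `ρ` live in `WithBot m.syn`, i.e. `ℕ^s ∪ {-∞}` with `ℕ^s` ordered by `m`. -/
structure IsOrderDomain (F : Type*) [Field F] {R : Type*} [CommRing R] [Algebra F R]
    {s : ℕ} (m : MonomialOrder (Fin s)) (Γ : AddSubmonoid (Fin s →₀ ℕ))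
    (ρ : R → WithBot m.syn) : Prop where
  range_eq : Set.range ρ = insert ⊥ {x | ∃ η ∈ Γ, x = ((m.toSyn η : m.syn) : WithBot m.syn)}
  eq_bot_iff : ∀ f, ρ f = ⊥ ↔ f = 0
  smul : ∀ (a : F) (f : R), a ≠ 0 → ρ (a • f) = ρ f
  add_le : ∀ f g, ρ (f + g) ≤ max (ρ f) (ρ g)
  add_eq : ∀ f g, ρ f < ρ g → ρ (f + g) = max (ρ f) (ρ g)
  mul_lt_mul : ∀ f g h, ρ f < ρ g → h ≠ 0 → ρ (f * h) < ρ (g * h)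
  exists_sub_lt : ∀ f g, f ≠ 0 → g ≠ 0 → ρ f = ρ g → ∃ a : F, a ≠ 0 ∧ ρ (f - a • g) < ρ g
  mul : ∀ f g, f ≠ 0 → g ≠ 0 → ρ (f * g) = ρ f + ρ g

/-! ### The set `Δ` and the function `σ_Δ` -/

section Delta

variable {s : ℕ} (m : MonomialOrder (Fin s)) {Γ : AddSubmonoid (Fin s →₀ ℕ)}

/-- The smallest element, with respect to `m`, of a set of elements of `Γ` (and `0` if the set
is empty). -/
def leastElt (S : Set Γ) : Γ :=
  open Classical in
  if hS : S.Nonempty then Function.argminOn (fun η : Γ => m.toSyn (η : Fin s →₀ ℕ)) S hS else 0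

variable {K : Type*} [Field K] {S : Type*} [CommRing S] [Algebra K S]

/-- The sequence `α(1), α(2), …` (here indexed from `0`) of elements of `Γ`:
`α(1) = 0`, and `α(i)` is the smallest element `μ` of `Γ` that is greater than
`α(1), …, α(i-1)` and satisfies `φ(f_μ) ∉ Span {φ(f_ν) | ν ≺ μ}`. -/
def alpha (f : Module.Basis Γ K S) {h : ℕ} (φ : S →ₙₐ[K] (Fin h → K)) : ℕ → Γ
  | 0 => 0
  | i + 1 => leastElt m {μ : Γ |
      (∀ j : Fin (i + 1), (alpha f φ j : Fin s →₀ ℕ) ≺[m] (μ : Fin s →₀ ℕ)) ∧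
      φ (f μ) ∉ Submodule.span K
        {x | ∃ ν : Γ, (ν : Fin s →₀ ℕ) ≺[m] (μ : Fin s →₀ ℕ) ∧ x = φ (f ν)}}

/-- `Δ = {α(1), …, α(h)}`, where `h` is the length of the vectors in the image of `φ`. -/
def Delta (f : Module.Basis Γ K S) {h : ℕ} (φ : S →ₙₐ[K] (Fin h → K)) : Set Γ :=
  {μ | ∃ i < h, μ = alpha m f φ i}

/-- `σ_D(η) = |{μ ∈ D | μ - η ∈ Γ}|`. -/
def sigma (D : Set Γ) (η : Γ) : ℕ∞ :=
  {μ | μ ∈ D ∧ ∃ ν : Γ, μ = η + ν}.encard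

end Delta

/-! ### Minimum distance -/

/-- The minimum distance of a linear code: the least Hamming distance of two distinct codewords
(`⊤` for the zero code, which has no two distinct codewords). -/
def minDist {F : Type*} [Field F] {ι : Type*} [Fintype ι] (C : Submodule F (ι → F)) : ℕ∞ :=
  open Classical in
  ⨅ (x ∈ C) (y ∈ C) (_ : x ≠ y), (hammingDist x y : ℕ∞)

/-! ### Extended order domain codes -/

section Extended

variable (F : Type*) [Field F] [Fintype F] (K : Type*) [Field K] [Algebra F K]

/-- For `F = 𝔽_q` and `K = 𝔽_{q^r}`, the elements of `K` in `𝔽_{q^l}`, that is those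
with `x ^ (q ^ l) = x`. It is the subfield of `K` of order `q ^ l` when `l ∣ r`. -/
def GFsub (l : ℕ) : IntermediateField F K where
  carrier := {x | x ^ (Fintype.card F ^ l) = x}
  mul_mem' {a b} ha hb := by
    simp only [Set.mem_ofPred_eq] at *
    rw [mul_pow, ha, hb]
  add_mem' {a b} ha hb := by
    have key : ∀ x : K, ((FiniteField.frobeniusAlgHom F K) ^ l) x = x ^ (Fintype.card F ^ l) := by
      intro x
      rw [AlgHom.coe_pow, FiniteField.coe_frobeniusAlgHom, pow_iterate]
    simp only [Set.mem_ofPred_eq, ← key] at *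
    rw [map_add, ha, hb]
  algebraMap_mem' a := by
    simp only [Set.mem_ofPred_eq]
    rw [← map_pow, FiniteField.pow_card_pow]
  inv_mem' a ha := by
    simp only [Set.mem_ofPred_eq] at *
    rw [inv_pow, ha]

variable {F K} {R : Type*} [CommRing R] [Algebra F R] {h : ℕ}

/-- `r_i = min {l | φ_i(R) ⊆ 𝔽_{q^l}}`, for a morphism `φ = (φ_1, …, φ_h)` defined on the
extension `R' = K ⊗[F] R` of `R`; here `𝔽_{q^l}` runs through the subfields of `K`
containing `F`, which correspond to the divisors `l` of `[K : F]`. -/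
def valueDegree (φ : (K ⊗[F] R) →ₙₐ[K] (Fin h → K)) (i : Fin h) : ℕ :=
  sInf {l | l ∣ Module.finrank F K ∧ ∀ g : R, φ ((1 : K) ⊗ₜ[F] g) i ∈ GFsub F K l}

theorem apply_mem [Finite K] (φ : (K ⊗[F] R) →ₙₐ[K] (Fin h → K)) (i : Fin h) (g : R) :
    φ ((1 : K) ⊗ₜ[F] g) i ∈ GFsub F K (valueDegree φ i) := by
  have hne : {l | l ∣ Module.finrank F K ∧
      ∀ g : R, φ ((1 : K) ⊗ₜ[F] g) i ∈ GFsub F K l}.Nonempty := by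
    refine ⟨Module.finrank F K, dvd_rfl, fun g => ?_⟩
    change _ ^ (Fintype.card F ^ Module.finrank F K) = _
    have := Fintype.ofFinite K
    rw [← Module.card_eq_pow_finrank (K := F) (V := K)]
    exact FiniteField.pow_card _
  exact (Nat.sInf_mem hne).2 g

variable [Finite K] {n : Fin h → ℕ} {C : ∀ i, Submodule F (Fin (n i) → F)}

/-- The vector `(π_1(φ_1(g)), …, π_h(φ_h(g)))` of length `n_1 + ⋯ + n_h`, for `g ∈ R`. -/
def concat (φ : (K ⊗[F] R) →ₙₐ[K] (Fin h → K))
    (π : ∀ i, GFsub F K (valueDegree φ i) ≃ₗ[F] C i) (g : R) :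
    (Σ i, Fin (n i)) → F :=
  fun j => (π j.1 ⟨φ ((1 : K) ⊗ₜ[F] g) j.1, apply_mem φ j.1 g⟩ : Fin (n j.1) → F) j.2

variable {s : ℕ} (m : MonomialOrder (Fin s)) {Γ : AddSubmonoid (Fin s →₀ ℕ)}

/-- The extended code `E(lam, R, C)`. -/
def extCode (f : Module.Basis Γ F R) (φ : (K ⊗[F] R) →ₙₐ[K] (Fin h → K))
    (π : ∀ i, GFsub F K (valueDegree φ i) ≃ₗ[F] C i) (lam : Γ) :
    Submodule F ((Σ i, Fin (n i)) → F) :=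
  Submodule.span F
    {c | ∃ η : Γ, (η : Fin s →₀ ℕ) ≼[m] (lam : Fin s →₀ ℕ) ∧ c = concat φ π (f η)}

/-- The set `Δ` of the extension `R' = K ⊗[F] R`, with respect to the `K`-basis of `R'` given
by the `F`-basis `f` of `R`. -/
def extDelta (f : Module.Basis Γ F R) (φ : (K ⊗[F] R) →ₙₐ[K] (Fin h → K)) : Set Γ :=
  Delta m (f.baseChange K) φ

/-- The extended code `Ê(δ, R, C)`. -/
def extCodeHat (f : Module.Basis Γ F R) (φ : (K ⊗[F] R) →ₙₐ[K] (Fin h → K))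
    (π : ∀ i, GFsub F K (valueDegree φ i) ≃ₗ[F] C i) (δ : ℕ) :
    Submodule F ((Σ i, Fin (n i)) → F) :=
  Submodule.span F
    {c | ∃ η : Γ, η ∈ extDelta m f φ ∧ (δ : ℕ∞) ≤ sigma (extDelta m f φ) η ∧
      c = concat φ π (f η)}

end Extended

end OrderDomain

end

/-! Let `v η = φ(f_η)` and filter `K^h` by the spans of the `v ν` with `ν ≺ η`; call `η` a jump if
`v η` lies outside its lower span. A nonzero `c = φ(g)` is `a • v η`, `a ≠ 0`, plus lower terms.
Since `φ` and `ρ` respect products, `c * v ν` is a nonzero multiple of `v (η + ν)` modulo its lower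
span. If `η + ν` runs through `Δ`, which consists of jumps, these products are independent, so `c`,
whose weight is the rank of multiplication by `c`, has weight at least `σ_Δ(η)`
(`encard_shift_le_hammingNorm`). Each nonzero coordinate of `c` then expands to a nonzero word of
some `C_i`, which gives the factor `d̂`. For `E` the leading index must be found in `Δ`: jumps up to
`λ` suffice to span (`mem_span_jumps`), and `Δ` contains every jump
(`mem_Delta_of_notMem_lowerSpan`). -/

namespace OrderDomain

/-! ### Filtrations by lower spans and their jumps -/

section Filtration

variable {K : Type*} [Field K] {V : Type*} [AddCommGroup V] [Module K V]
  {ι T : Type*} [LinearOrder T]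

/-- The span of the vectors `v ν` whose index has a key `t ν` below the key of `η`. -/
def lowerSpan (K : Type*) [Field K] {V : Type*} [AddCommGroup V] [Module K V]
    {ι T : Type*} [LinearOrder T] (t : ι → T) (v : ι → V) (η : ι) : Submodule K V :=
  Submodule.span K (v '' {ν | t ν < t η})

theorem lowerSpan_mono {t : ι → T} {v : ι → V} {η μ : ι} (h : t η ≤ t μ) :
    lowerSpan K t v η ≤ lowerSpan K t v μ :=
  Submodule.span_mono (Set.image_mono fun _ hν => lt_of_lt_of_le hν h)

theorem mem_lowerSpan {t : ι → T} {v : ι → V} {η μ : ι} (h : t η < t μ) :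
    v η ∈ lowerSpan K t v μ :=
  Submodule.subset_span ⟨η, h, rfl⟩

/-- Vectors that leave, one after the other, the members of a flag are linearly independent. -/
theorem linearIndependent_of_flag {J : Type*} {t : J → T} (ht : Function.Injective t)
    (U : J → Submodule K V) (w : J → V) (hlt : ∀ i j, t i < t j → w i ∈ U j)
    (hself : ∀ j, w j ∉ U j) : LinearIndependent K w := by
  classical
  rw [linearIndependent_iff']
  intro S g hg i hi
  by_contra hgi
  obtain ⟨j, hj, hmax⟩ := (S.filter fun i => g i ≠ 0).exists_max_image t
    ⟨i, Finset.mem_filter.2 ⟨hi, hgi⟩⟩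
  obtain ⟨hjS, hgj⟩ := Finset.mem_filter.1 hj
  refine hself j ?_
  rw [← Submodule.smul_mem_iff _ hgj]
  rw [← Finset.add_sum_erase S _ hjS] at hg
  rw [eq_neg_of_add_eq_zero_left hg]
  refine neg_mem (sum_mem fun k hk => ?_)
  obtain ⟨hkj, hkS⟩ := Finset.mem_erase.1 hk
  by_cases hgk : g k = 0
  · simp [hgk]
  · exact Submodule.smul_mem _ _ (hlt k j (lt_of_le_of_ne
      (hmax k (Finset.mem_filter.2 ⟨hkS, hgk⟩)) fun e => hkj (ht e)))

/-- The vectors may be dependent: any expression of `c` over `A` serves, and `η` is the largest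
index in its support. It need not be a jump. -/
theorem exists_leading_term {t : ι → T} (ht : Function.Injective t) (v : ι → V) {A : Set ι}
    {c : V} (hc : c ∈ Submodule.span K (v '' A)) (hc0 : c ≠ 0) :
    ∃ η ∈ A, ∃ a : K, a ≠ 0 ∧ c - a • v η ∈ lowerSpan K t v η := by
  classical
  obtain ⟨l, hl, rfl⟩ := (Finsupp.mem_span_image_iff_linearCombination K).1 hc
  have hl0 : l ≠ 0 := by
    rintro rfl
    simp at hc0
  obtain ⟨η, hη, hmax⟩ := l.support.exists_max_image t (Finsupp.support_nonempty_iff.2 hl0)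
  refine ⟨η, hl hη, l η, Finsupp.mem_support_iff.1 hη, ?_⟩
  rw [Finsupp.linearCombination_apply, Finsupp.sum, ← Finset.add_sum_erase _ _ hη,
    add_sub_cancel_left]
  refine sum_mem fun k hk => Submodule.smul_mem _ _ (mem_lowerSpan ?_)
  obtain ⟨hkη, hkl⟩ := Finset.mem_erase.1 hk
  exact lt_of_le_of_ne (hmax k hkl) fun e => hkη (ht e)

/-- Well-founded induction: a vector that is not at a jump is a combination of earlier ones. -/
theorem mem_span_jumps [WellFoundedLT T] (t : ι → T) (v : ι → V) (μ : ι) :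
    v μ ∈ Submodule.span K (v '' {η | v η ∉ lowerSpan K t v η ∧ t η ≤ t μ}) := by
  induction μ using (InvImage.wf t (wellFounded_lt (α := T))).induction with
  | _ μ ih =>
    by_cases hμ : v μ ∈ lowerSpan K t v μ
    · refine (Submodule.span_le.2 ?_ : lowerSpan K t v μ ≤ _) hμ
      rintro _ ⟨ν, hν, rfl⟩
      refine Submodule.span_mono (Set.image_mono ?_) (ih ν hν)
      exact fun η hη => ⟨hη.1, hη.2.trans (le_of_lt hν)⟩
    · exact Submodule.subset_span ⟨μ, ⟨hμ, le_rfl⟩, rfl⟩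

end Filtration

/-! ### Hamming weight from leading terms -/

section Weight

variable {K : Type*} [Field K] [DecidableEq K] {X : Type*} [Fintype X]

/-- The rank of the multiplication by `c` is the Hamming weight of `c`. -/
theorem card_le_hammingNorm_of_linearIndependent {J : Type*} [Fintype J] (c : X → K)
    (y : J → X → K) (hw : LinearIndependent K fun j => c * y j) :
    Fintype.card J ≤ hammingNorm c := by
  -- The products vanish off the support of `c`, so they live in a space whose dimension is the
  -- weight of `c`.
  let w' : J → {x // c x ≠ 0} → K := fun j x => c x * y j x
  have hw' : LinearIndependent K w' := by
    refine LinearIndependent.of_comp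
      (Function.ExtendByZero.linearMap K (Subtype.val : {x // c x ≠ 0} → X)) ?_
    convert hw using 1
    ext j x
    by_cases hx : c x = 0
    · simp [hx, Function.extend_apply']
    · exact Subtype.val_injective.extend_apply (w' j) 0 (⟨x, hx⟩ : {x // c x ≠ 0})
  have := hw'.fintype_card_le_finrank
  rwa [Module.finrank_fintype_fun_eq_card, Fintype.card_subtype] at this

theorem encard_shift_le_hammingNorm {ι T : Type*} [AddCommMonoid ι] [AddCommMonoid T]
    [LinearOrder T] [IsOrderedCancelAddMonoid T] (t : ι →+ T) (ht : Function.Injective t)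
    (v : ι → X → K)
    (hmul : ∀ τ ν, ∃ b : K, b ≠ 0 ∧ v τ * v ν - b • v (τ + ν) ∈ lowerSpan K t v (τ + ν))
    {D : Set ι} (hD : ∀ μ ∈ D, v μ ∉ lowerSpan K t v μ) {c : X → K} {η : ι} {a : K}
    (ha : a ≠ 0) (hc : c - a • v η ∈ lowerSpan K t v η) :
    {μ | μ ∈ D ∧ ∃ ν, μ = η + ν}.encard ≤ hammingNorm c := by
  -- Lower terms stay lower after multiplication, because the order is translation invariant.
  have hlow : ∀ ν, ∀ x ∈ lowerSpan K t v η, x * v ν ∈ lowerSpan K t v (η + ν) := by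
    intro ν x hx
    refine Submodule.span_induction ?_ (by simp) (fun x y _ _ hx hy => ?_)
      (fun b x _ hx => ?_) hx
    · rintro _ ⟨τ, hτ, rfl⟩
      obtain ⟨b, -, hb⟩ := hmul τ ν
      have hlt : t (τ + ν) < t (η + ν) := by
        rw [map_add, map_add]
        exact add_lt_add_left (α := T) hτ (t ν)
      have := add_mem (lowerSpan_mono hlt.le hb)
        (Submodule.smul_mem _ b (mem_lowerSpan (K := K) (v := v) hlt))
      simpa using this
    · rw [add_mul]
      exact add_mem hx hy
    · rw [smul_mul_assoc]
      exact Submodule.smul_mem _ _ hx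
  have hlead : ∀ ν, ∃ b : K, b ≠ 0 ∧ c * v ν - b • v (η + ν) ∈ lowerSpan K t v (η + ν) := by
    intro ν
    obtain ⟨b, hb0, hb⟩ := hmul η ν
    refine ⟨a * b, mul_ne_zero ha hb0, ?_⟩
    have := add_mem (hlow ν _ hc) (Submodule.smul_mem _ a hb)
    rwa [sub_mul, smul_mul_assoc, smul_sub, smul_smul, sub_add_sub_cancel] at this
  set M : Set ι := {μ | μ ∈ D ∧ ∃ ν, μ = η + ν}
  have hν : ∀ μ : M, ∃ ν, (μ : ι) = η + ν := fun μ => μ.2.2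
  choose y hy using hν
  have hind : LinearIndependent K fun μ : M => c * v (y μ) := by
    refine linearIndependent_of_flag (t := fun μ : M => t μ) (ht.comp Subtype.val_injective)
      (fun μ : M => lowerSpan K t v μ) _ ?_ ?_
    · intro i j hij
      obtain ⟨b, -, hb⟩ := hlead (y i)
      rw [← hy] at hb
      simpa using add_mem (lowerSpan_mono hij.le hb)
        (Submodule.smul_mem _ b (mem_lowerSpan (K := K) (v := v) hij))
    · intro j hj
      obtain ⟨b, hb0, hb⟩ := hlead (y j)
      rw [← hy] at hb
      refine hD j j.2.1 ((Submodule.smul_mem_iff _ hb0).1 ?_)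
      simpa using sub_mem hj hb
  -- `D` may be infinite; independence in a finite-dimensional space bounds `M`.
  have : Fintype M := by
    have := hind.finite
    exact Fintype.ofFinite M
  have hcard := card_le_hammingNorm_of_linearIndependent c (fun μ => v (y μ)) hind
  rw [Set.encard_eq_coe_toFinset_card, Set.toFinset_card]
  exact_mod_cast hcard

end Weight

/-! ### Leading terms in an order domain -/

section WeightFunction

variable {F : Type*} [Field F] {R : Type*} [CommRing R] [Algebra F R] {s : ℕ}
  {m : MonomialOrder (Fin s)} {Γ : AddSubmonoid (Fin s →₀ ℕ)} {ρ : R → WithBot m.syn}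

/-- The elements of `Γ` as elements of `ℕ^s` ordered by `m`. -/
noncomputable def key (m : MonomialOrder (Fin s)) (Γ : AddSubmonoid (Fin s →₀ ℕ)) : Γ →+ m.syn :=
  (m.toSyn : (Fin s →₀ ℕ) →+ m.syn).comp Γ.subtype

theorem key_injective : Function.Injective (key m Γ) :=
  m.toSyn.injective.comp Subtype.val_injective

theorem IsOrderDomain.exists_key_eq (hρ : IsOrderDomain F m Γ ρ) {g : R} (hg : g ≠ 0) :
    ∃ η : Γ, ρ g = (key m Γ η : WithBot m.syn) := by
  have := hρ.range_eq ▸ Set.mem_range_self g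
  rcases this with h | ⟨η, hη, h⟩
  · exact absurd ((hρ.eq_bot_iff g).1 h) hg
  · exact ⟨⟨η, hη⟩, h⟩

theorem IsOrderDomain.ne_zero_of_key (hρ : IsOrderDomain F m Γ ρ) {f : Γ → R}
    (hf : ∀ η : Γ, ρ (f η) = (key m Γ η : WithBot m.syn))
    (η : Γ) : f η ≠ 0 := by
  intro h
  have := (hρ.eq_bot_iff _).2 h
  rw [hf] at this
  exact WithBot.coe_ne_bot this

/-- Reduction by leading terms: subtracting a multiple of the `f τ` of equal weight lowers `ρ`, and
this terminates since monomial orders are well-founded. -/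
theorem IsOrderDomain.mem_lowerSpan_of_lt (hρ : IsOrderDomain F m Γ ρ) {f : Γ → R}
    (hf : ∀ η : Γ, ρ (f η) = (key m Γ η : WithBot m.syn))
    {g : R} {η : Γ}
    (hg : ρ g < (key m Γ η : WithBot m.syn)) : g ∈ lowerSpan F (key m Γ) f η := by
  induction g using (InvImage.wf ρ (wellFounded_lt (α := WithBot m.syn))).induction with
  | _ g ih =>
    by_cases hg0 : g = 0
    · rw [hg0]
      exact zero_mem _
    obtain ⟨τ, hτ⟩ := hρ.exists_key_eq hg0
    obtain ⟨a, -, ha⟩ := hρ.exists_sub_lt g (f τ) hg0 (hρ.ne_zero_of_key hf τ)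
      (hτ.trans (hf τ).symm)
    have hlt : key m Γ τ < key m Γ η := by
      rw [hτ] at hg
      exact WithBot.coe_lt_coe.1 hg
    rw [hf, ← hτ] at ha
    simpa using add_mem (ih _ ha (ha.trans hg))
      (Submodule.smul_mem _ a (mem_lowerSpan (K := F) (v := f) hlt))

theorem IsOrderDomain.exists_mul_sub_mem_lowerSpan (hρ : IsOrderDomain F m Γ ρ) {f : Γ → R}
    (hf : ∀ η : Γ, ρ (f η) = (key m Γ η : WithBot m.syn))
    (τ ν : Γ) :
    ∃ b : F, b ≠ 0 ∧ f τ * f ν - b • f (τ + ν) ∈ lowerSpan F (key m Γ) f (τ + ν) := by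
  have hmul : ρ (f τ * f ν) = ρ (f (τ + ν)) := by
    rw [hρ.mul _ _ (hρ.ne_zero_of_key hf τ) (hρ.ne_zero_of_key hf ν), hf, hf, hf, map_add,
      WithBot.coe_add]
  have hne : f τ * f ν ≠ 0 := by
    intro h
    exact hρ.ne_zero_of_key hf (τ + ν) ((hρ.eq_bot_iff _).1 (hmul ▸ (hρ.eq_bot_iff _).2 h))
  obtain ⟨b, hb0, hb⟩ := hρ.exists_sub_lt _ _ hne (hρ.ne_zero_of_key hf _) hmul
  rw [hf] at hb
  exact ⟨b, hb0, hρ.mem_lowerSpan_of_lt hf hb⟩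

/-- From `1 * 1 = 1` the weight of `1` is `0`, the least one; subtracting a multiple of `f 0`
therefore leaves nothing. -/
theorem IsOrderDomain.exists_one_eq_smul (hρ : IsOrderDomain F m Γ ρ) {f : Γ → R}
    (hf : ∀ η : Γ, ρ (f η) = (key m Γ η : WithBot m.syn))
    [Nontrivial R] : ∃ a : F, (1 : R) = a • f 0 := by
  obtain ⟨η, hη⟩ := hρ.exists_key_eq (one_ne_zero (α := R))
  have h1 := hρ.mul 1 1 one_ne_zero one_ne_zero
  rw [mul_one, hη, ← WithBot.coe_add, WithBot.coe_inj, left_eq_add] at h1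
  have h0 : ρ 1 = ρ (f 0) := by rw [hη, hf, h1, map_zero]
  obtain ⟨a, -, ha⟩ := hρ.exists_sub_lt 1 (f 0) one_ne_zero (hρ.ne_zero_of_key hf 0) h0
  refine ⟨a, ?_⟩
  by_contra hne
  obtain ⟨τ, hτ⟩ := hρ.exists_key_eq (sub_ne_zero.2 hne)
  rw [hτ, hf, map_zero, WithBot.coe_lt_coe] at ha
  exact not_lt_bot (a := key m Γ τ) (by simpa using ha)

end WeightFunction

/-! ### Restricting `φ` to `R` -/

section Extension

variable {F : Type*} [Field F] {K : Type*} [Field K] [Algebra F K]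
  {R : Type*} [CommRing R] [Algebra F R] {h : ℕ} (φ : (K ⊗[F] R) →ₙₐ[K] (Fin h → K))

/-- The restriction of `φ` to `R`. -/
def restrictBase : R →ₗ[F] (Fin h → K) :=
  ((φ : (K ⊗[F] R) →ₗ[K] (Fin h → K)).restrictScalars F).comp (TensorProduct.mk F K R 1)

@[simp]
theorem restrictBase_apply (g : R) : restrictBase φ g = φ ((1 : K) ⊗ₜ[F] g) := rfl

theorem restrictBase_mul (g k : R) :
    restrictBase φ (g * k) = restrictBase φ g * restrictBase φ k := by
  simp [← map_mul]

theorem restrictBase_one (hφ : Function.Surjective φ) : restrictBase φ 1 = 1 := by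
  -- `φ` is not assumed unital; a preimage of the all-ones vector forces `φ(1) = 1`.
  obtain ⟨x, hx⟩ := hφ 1
  have := map_mul φ x 1
  rw [mul_one, hx, one_mul] at this
  exact this.symm

theorem restrictBase_mem_span {ι : Type*} {f : ι → R} {A : Set ι} {g : R}
    (hg : g ∈ Submodule.span F (f '' A)) :
    restrictBase φ g ∈ Submodule.span K ((fun η => restrictBase φ (f η)) '' A) := by
  refine (Submodule.span_le.2 ?_ : Submodule.span F (f '' A) ≤
    ((Submodule.span K ((fun η => restrictBase φ (f η)) '' A)).restrictScalars F).comap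
      (restrictBase φ)) hg
  rintro _ ⟨η, hη, rfl⟩
  exact Submodule.subset_span ⟨η, hη, rfl⟩

theorem exists_restrictBase_mul_sub_mem_lowerSpan {s : ℕ} {m : MonomialOrder (Fin s)}
    {Γ : AddSubmonoid (Fin s →₀ ℕ)} {ρ : R → WithBot m.syn} (hρ : IsOrderDomain F m Γ ρ)
    {f : Γ → R} (hf : ∀ η : Γ, ρ (f η) = (key m Γ η : WithBot m.syn)) (τ ν : Γ) :
    ∃ b : K, b ≠ 0 ∧ restrictBase φ (f τ) * restrictBase φ (f ν) -
      b • restrictBase φ (f (τ + ν)) ∈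
        lowerSpan K (key m Γ) (fun η => restrictBase φ (f η)) (τ + ν) := by
  obtain ⟨b, hb0, hb⟩ := hρ.exists_mul_sub_mem_lowerSpan hf τ ν
  refine ⟨algebraMap F K b, by simpa using hb0, ?_⟩
  have := restrictBase_mem_span φ hb
  rwa [map_sub, restrictBase_mul, map_smul, ← algebraMap_smul K b] at this

end Extension

/-! ### `Δ` as the set of jumps -/

section Jumps

variable {s : ℕ} {m : MonomialOrder (Fin s)} {Γ : AddSubmonoid (Fin s →₀ ℕ)}
  {K : Type*} [Field K] {S : Type*} [CommRing S] [Algebra K S]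
  (f : Module.Basis Γ K S) {h : ℕ} (φ : S →ₙₐ[K] (Fin h → K))

theorem leastElt_mem {A : Set Γ} (hA : A.Nonempty) : leastElt m A ∈ A := by
  rw [leastElt, dif_pos hA]
  exact Function.argminOn_mem _ _ hA

theorem key_leastElt_le {A : Set Γ} {η : Γ} (hη : η ∈ A) :
    key m Γ (leastElt m A) ≤ key m Γ η := by
  rw [leastElt, dif_pos ⟨η, hη⟩]
  exact Function.argminOn_le _ _ hη

/-- The elements of `Γ` among which `alpha m f φ (i + 1)` is the smallest. -/
def alphaCandidates (m : MonomialOrder (Fin s)) (i : ℕ) : Set Γ :=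
  {μ | (∀ j ≤ i, key m Γ (alpha m f φ j) < key m Γ μ) ∧
    φ (f μ) ∉ lowerSpan K (key m Γ) (fun η => φ (f η)) μ}

theorem alpha_succ (i : ℕ) : alpha m f φ (i + 1) = leastElt m (alphaCandidates f φ m i) := by
  rw [alpha]
  congr 1
  ext μ
  have hset : {x | ∃ ν : Γ, (ν : Fin s →₀ ℕ) ≺[m] (μ : Fin s →₀ ℕ) ∧ x = φ (f ν)} =
      (fun η => φ (f η)) '' {ν | key m Γ ν < key m Γ μ} := by
    ext x
    exact exists_congr fun ν => and_congr Iff.rfl eq_comm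
  refine and_congr ?_ (by rw [hset]; rfl)
  exact ⟨fun H j hj => H ⟨j, Nat.lt_succ_of_le hj⟩, fun H j => H j (Nat.le_of_lt_succ j.2)⟩

theorem alpha_notMem_lowerSpan
    (h0 : φ (f 0) ∉ lowerSpan K (key m Γ) (fun η => φ (f η)) 0) (i : ℕ) :
    φ (f (alpha m f φ i)) ∉ lowerSpan K (key m Γ) (fun η => φ (f η)) (alpha m f φ i) := by
  cases i with
  | zero => simpa [alpha] using h0
  | succ i =>
    rw [alpha_succ]
    by_cases hne : (alphaCandidates f φ m i).Nonempty
    · exact (leastElt_mem hne).2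
    -- With no candidate left the default value is `0`, itself a jump by `h0`.
    · rw [leastElt, dif_neg hne]
      exact h0

/-- A missed jump `μ` would be a candidate at every step, so the `α(i)` would increase strictly
below it; with `μ` they would give `h + 1` independent vectors in `K^h`. -/
theorem mem_Delta_of_notMem_lowerSpan
    (h0 : φ (f 0) ∉ lowerSpan K (key m Γ) (fun η => φ (f η)) 0) {μ : Γ}
    (hμ : φ (f μ) ∉ lowerSpan K (key m Γ) (fun η => φ (f η)) μ) : μ ∈ Delta m f φ := by
  by_contra hΔ
  have hne : ∀ i < h, μ ≠ alpha m f φ i := fun i hi e => hΔ ⟨i, hi, e⟩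
  have hlt : ∀ i < h, key m Γ (alpha m f φ i) < key m Γ μ ∧
      ∀ j < i, key m Γ (alpha m f φ j) < key m Γ (alpha m f φ i) := by
    intro i
    induction i using Nat.strong_induction_on with
    | _ i ih =>
      intro hi
      have hne' : key m Γ (alpha m f φ i) ≠ key m Γ μ :=
        fun e => hne i hi (key_injective e).symm
      cases i with
      | zero =>
        refine ⟨lt_of_le_of_ne ?_ hne', by simp⟩
        rw [alpha, map_zero]
        exact bot_le
      | succ i =>
        have hmem : μ ∈ alphaCandidates f φ m i :=
          ⟨fun j hj => (ih j (by omega) (by omega)).1, hμ⟩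
        rw [alpha_succ] at hne' ⊢
        exact ⟨lt_of_le_of_ne (key_leastElt_le hmem) hne',
          fun j hj => (leastElt_mem ⟨μ, hmem⟩).1 j (by omega)⟩
  let e : Option (Fin h) → Γ := fun o => o.elim μ fun i => alpha m f φ i
  have he : Function.Injective e := by
    rintro (_ | i) (_ | j) hij
    · rfl
    · exact absurd hij (hne j j.2)
    · exact absurd hij.symm (hne i i.2)
    · rcases lt_trichotomy i j with hlt' | rfl | hlt'
      · exact absurd (congrArg (key m Γ) hij) ((hlt j j.2).2 i hlt').ne
      · rfl
      · exact absurd (congrArg (key m Γ) hij) ((hlt i i.2).2 j hlt').ne'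
  have hind : LinearIndependent K fun o => φ (f (e o)) := by
    refine linearIndependent_of_flag (t := fun o => key m Γ (e o)) (key_injective.comp he)
      (fun o => lowerSpan K (key m Γ) (fun η => φ (f η)) (e o)) _
      (fun i j hij => mem_lowerSpan (v := fun η => φ (f η)) hij) ?_
    rintro (_ | i)
    · exact hμ
    · exact alpha_notMem_lowerSpan f φ h0 i
  have := hind.fintype_card_le_finrank
  simp at this

end Jumps

/-! ### From weights in `K^h` to weights of concatenated words -/

section Codes

theorem minDist_le_hammingNorm {F : Type*} [Field F] [DecidableEq F] {ι : Type*} [Fintype ι]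
    {C : Submodule F (ι → F)} {x : ι → F} (hx : x ∈ C) (hx0 : x ≠ 0) :
    minDist C ≤ hammingNorm x := by
  refine (iInf₂_le x hx).trans ((iInf₂_le 0 (zero_mem C)).trans ((iInf_le _ hx0).trans ?_))
  rw [← hammingDist_zero_right]
  norm_cast
  exact le_of_eq (by congr!)

theorem le_minDist {F : Type*} [Field F] [DecidableEq F] {ι : Type*} [Fintype ι]
    {C : Submodule F (ι → F)} {w : ℕ∞} (hw : ∀ x ∈ C, x ≠ 0 → w ≤ hammingNorm x) :
    w ≤ minDist C := by
  refine le_iInf₂ fun x hx => le_iInf₂ fun y hy => le_iInf fun hxy => ?_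
  refine (hw (x - y) (sub_mem hx hy) (sub_ne_zero.2 hxy)).trans (Nat.cast_le.2 (le_of_eq ?_))
  simp only [hammingNorm, hammingDist, Pi.sub_apply, sub_ne_zero]

theorem hammingNorm_sigma {F : Type*} [Zero F] [DecidableEq F] {ι : Type*} [Fintype ι]
    {κ : ι → Type*} [∀ i, Fintype (κ i)] (c : (Σ i, κ i) → F) :
    hammingNorm c = ∑ i, hammingNorm fun j => c ⟨i, j⟩ := by
  simp only [hammingNorm, Finset.card_filter]
  exact Fintype.sum_sigma _

variable {F : Type*} [Field F] [Fintype F] {K : Type*} [Field K] [Finite K] [Algebra F K]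
  {R : Type*} [CommRing R] [Algebra F R] {h : ℕ} {φ : (K ⊗[F] R) →ₙₐ[K] (Fin h → K)}
  {n : Fin h → ℕ} {C : ∀ i, Submodule F (Fin (n i) → F)}
  (π : ∀ i, GFsub F K (valueDegree φ i) ≃ₗ[F] C i)

/-- `concat` as a linear map. -/
noncomputable def concatLinear : R →ₗ[F] ((Σ i, Fin (n i)) → F) where
  toFun := concat φ π
  map_add' g k := by
    ext j
    have : (⟨φ ((1 : K) ⊗ₜ[F] (g + k)) j.1, apply_mem φ j.1 (g + k)⟩ :
        GFsub F K (valueDegree φ j.1)) =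
        ⟨φ ((1 : K) ⊗ₜ[F] g) j.1, apply_mem φ j.1 g⟩ +
          ⟨φ ((1 : K) ⊗ₜ[F] k) j.1, apply_mem φ j.1 k⟩ :=
      Subtype.ext (congrFun (map_add (restrictBase φ) g k) j.1)
    simp only [concat, this, map_add]
    rfl
  map_smul' a g := by
    ext j
    have : (⟨φ ((1 : K) ⊗ₜ[F] (a • g)) j.1, apply_mem φ j.1 (a • g)⟩ :
        GFsub F K (valueDegree φ j.1)) =
        a • ⟨φ ((1 : K) ⊗ₜ[F] g) j.1, apply_mem φ j.1 g⟩ :=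
      Subtype.ext (congrFun (map_smul (restrictBase φ) a g) j.1)
    simp only [concat, this, map_smul]
    rfl

theorem exists_concat_eq_of_mem_span {ι : Type*} {f : ι → R} {A : Set ι}
    {c : (Σ i, Fin (n i)) → F}
    (hc : c ∈ Submodule.span F ((fun η => concat φ π (f η)) '' A)) :
    ∃ g ∈ Submodule.span F (f '' A), concat φ π g = c := by
  have : (fun η => concat φ π (f η)) '' A = concatLinear π '' (f '' A) := by
    rw [Set.image_image]
    rfl
  rw [this, ← Submodule.map_span] at hc
  exact hc

theorem restrictBase_ne_zero_of_concat_ne_zero {g : R} (hg : concat φ π g ≠ 0) :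
    restrictBase φ g ≠ 0 := by
  intro h0
  refine hg (funext fun j => ?_)
  have : (⟨φ ((1 : K) ⊗ₜ[F] g) j.1, apply_mem φ j.1 g⟩ :
      GFsub F K (valueDegree φ j.1)) = 0 := Subtype.ext (congrFun h0 j.1)
  simp [concat, this]

theorem hammingNorm_mul_le_hammingNorm_concat [DecidableEq F] [DecidableEq K] (d : Fin h → ℕ)
    (hd : ∀ i, minDist (C i) = (d i : ℕ∞)) (g : R) :
    (hammingNorm (restrictBase φ g) : ℕ∞) * (⨅ i, (d i : ℕ∞)) ≤
      hammingNorm (concat φ π g) := by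
  rw [hammingNorm_sigma, hammingNorm, ← nsmul_eq_mul, ← Finset.sum_const, Nat.cast_sum]
  refine (Finset.sum_le_sum fun i hi => ?_).trans
    (Finset.sum_le_sum_of_subset (Finset.subset_univ _))
  have hi0 := (Finset.mem_filter.1 hi).2
  refine (iInf_le _ i).trans ?_
  rw [← hd]
  let x : GFsub F K (valueDegree φ i) := ⟨φ ((1 : K) ⊗ₜ[F] g) i, apply_mem φ i g⟩
  have hx : x ≠ 0 := fun e => hi0 (congrArg Subtype.val e)
  refine minDist_le_hammingNorm (x := ((π i x : C i) : Fin (n i) → F)) (π i x).2 ?_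
  simpa using hx

end Codes

end OrderDomain

/-! ### The two distance bounds -/

theorem mainTheorem2
    {F : Type*} [Field F] [Fintype F] {K : Type*} [Field K] [Finite K] [Algebra F K]
    {R : Type*} [CommRing R] [Algebra F R]
    {s : ℕ} (m : MonomialOrder (Fin s)) (Γ : AddSubmonoid (Fin s →₀ ℕ))
    (ρ : R → WithBot m.syn) (hρ : OrderDomain.IsOrderDomain F m Γ ρ)
    (f : Module.Basis Γ F R)
    (hf : ∀ η : Γ, ρ (f η) = ((m.toSyn (η : Fin s →₀ ℕ) : m.syn) : WithBot m.syn))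
    {h : ℕ} (φ : (K ⊗[F] R) →ₙₐ[K] (Fin h → K)) (hφ : Function.Surjective φ)
    (n : Fin h → ℕ) (C : ∀ i, Submodule F (Fin (n i) → F)) (d : Fin h → ℕ)
    (hd : ∀ i, OrderDomain.minDist (C i) = (d i : ℕ∞))
    (π : ∀ i, OrderDomain.GFsub F K (OrderDomain.valueDegree φ i) ≃ₗ[F] C i) :
    (∀ lam : Γ,
      (⨅ η ∈ {η : Γ | η ∈ OrderDomain.extDelta m f φ ∧
          (η : Fin s →₀ ℕ) ≼[m] (lam : Fin s →₀ ℕ)},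
        OrderDomain.sigma (OrderDomain.extDelta m f φ) η) * (⨅ i, (d i : ℕ∞))
      ≤ OrderDomain.minDist (OrderDomain.extCode m f φ π lam)) ∧
    (∀ δ : ℕ,
      (δ : ℕ∞) * (⨅ i, (d i : ℕ∞))
      ≤ OrderDomain.minDist (OrderDomain.extCodeHat m f φ π δ)) := by
  classical
  -- For `h = 0` both codes are zero; otherwise `1 ≠ 0` in `K^h`, which makes `0` a jump.
  rcases Nat.eq_zero_or_pos h with rfl | hpos
  · have hsub : Subsingleton ((Σ i, Fin (n i)) → F) := inferInstance
    exact ⟨fun lam => OrderDomain.le_minDist fun x _ hx => absurd (Subsingleton.elim x 0) hx,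
      fun δ => OrderDomain.le_minDist fun x _ hx => absurd (Subsingleton.elim x 0) hx⟩
  set t := OrderDomain.key m Γ
  set v : Γ → Fin h → K := fun η => OrderDomain.restrictBase φ (f η)
  have hv : ∀ η, φ (f.baseChange K η) = v η := fun η => by
    simp [v]
  have hv' : (fun η => φ (f.baseChange K η)) = v := funext hv
  have h0 : φ (f.baseChange K 0) ∉
      OrderDomain.lowerSpan K t (fun η => φ (f.baseChange K η)) 0 := by
    have hR : OrderDomain.restrictBase φ (1 : R) ≠ 0 := by
      rw [OrderDomain.restrictBase_one φ hφ]
      exact fun e => one_ne_zero (congrFun e ⟨0, hpos⟩)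
    have : Nontrivial R := ⟨⟨1, 0, fun e => hR (by rw [e, map_zero])⟩⟩
    obtain ⟨a, ha⟩ := hρ.exists_one_eq_smul hf
    have hempty : {ν | t ν < t 0} = ∅ :=
      Set.eq_empty_of_forall_notMem fun ν hν => not_lt_bot (a := t ν) (by
        simpa using hν)
    rw [OrderDomain.lowerSpan, hempty, Set.image_empty, Submodule.span_empty,
      Submodule.mem_bot, hv]
    intro e
    refine hR ?_
    rw [ha, map_smul]
    exact (congrArg (a • ·) e).trans (smul_zero a)
  have hΔ : ∀ μ ∈ OrderDomain.extDelta m f φ, v μ ∉ OrderDomain.lowerSpan K t v μ := by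
    rintro μ ⟨i, -, rfl⟩
    have := OrderDomain.alpha_notMem_lowerSpan (f.baseChange K) φ h0 i
    rwa [hv', hv] at this
  have hΔ' : ∀ μ, v μ ∉ OrderDomain.lowerSpan K t v μ → μ ∈ OrderDomain.extDelta m f φ := by
    intro μ hμ
    refine OrderDomain.mem_Delta_of_notMem_lowerSpan (f.baseChange K) φ h0 ?_
    rwa [hv', hv]
  have key : ∀ (A : Set Γ) (w : ℕ∞), (∀ η ∈ A, w ≤ OrderDomain.sigma
      (OrderDomain.extDelta m f φ) η) → ∀ g : R, OrderDomain.concat φ π g ≠ 0 →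
      OrderDomain.restrictBase φ g ∈ Submodule.span K (v '' A) →
      w * (⨅ i, (d i : ℕ∞)) ≤ hammingNorm (OrderDomain.concat φ π g) := by
    intro A w hw g hg hgA
    obtain ⟨η, hη, a, ha, hc⟩ := OrderDomain.exists_leading_term (t := t)
      OrderDomain.key_injective v hgA
      (OrderDomain.restrictBase_ne_zero_of_concat_ne_zero π hg)
    refine le_trans ?_ (OrderDomain.hammingNorm_mul_le_hammingNorm_concat π d hd g)
    gcongr
    exact (hw η hη).trans (OrderDomain.encard_shift_le_hammingNorm t OrderDomain.key_injective v
      (OrderDomain.exists_restrictBase_mul_sub_mem_lowerSpan φ hρ hf) hΔ ha hc)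
  refine ⟨fun lam => OrderDomain.le_minDist fun x hx hx0 => ?_,
    fun δ => OrderDomain.le_minDist fun x hx hx0 => ?_⟩
  · obtain ⟨g, hg, rfl⟩ := OrderDomain.exists_concat_eq_of_mem_span (f := f) π
      (A := {η | t η ≤ t lam}) (c := x) (by
        refine Submodule.span_mono ?_ hx
        rintro _ ⟨η, hη, rfl⟩
        exact ⟨η, hη, rfl⟩)
    refine key {η | η ∈ OrderDomain.extDelta m f φ ∧ t η ≤ t lam} _
      (fun η hη => iInf₂_le η hη) g hx0 ?_
    -- Generators up to `λ` are replaced by jumps up to `λ`, all in `Δ`.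
    refine (Submodule.span_le.2 ?_) (OrderDomain.restrictBase_mem_span φ hg)
    rintro _ ⟨η, hη, rfl⟩
    refine Submodule.span_mono (Set.image_mono ?_) (OrderDomain.mem_span_jumps t v η)
    exact fun μ hμ => ⟨hΔ' μ hμ.1, hμ.2.trans hη⟩
  · obtain ⟨g, hg, rfl⟩ := OrderDomain.exists_concat_eq_of_mem_span (f := f) π
      (A := {η | η ∈ OrderDomain.extDelta m f φ ∧
        (δ : ℕ∞) ≤ OrderDomain.sigma (OrderDomain.extDelta m f φ) η}) (c := x) (by
        refine Submodule.span_mono ?_ hx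
        rintro _ ⟨η, hη, hδ, rfl⟩
        exact ⟨η, ⟨hη, hδ⟩, rfl⟩)
    exact key _ _ (fun η hη => hη.2) g hx0 (OrderDomain.restrictBase_mem_span φ hg)
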